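/- Let $-\infty<a<b<\infty$, $1\le p<\infty$ and $n\in\mathbb N=\{1,2,\dots\}$. In the (real or complex) space $L_p(a,b)$ consider the $n$th derivative operator $D^nf:=f^{(n)}$ with the maximal domain $$D(D^n):=W_p^n(a,b):=\bigl\{f\in L_p(a,b)\;\big|\; f(\cdot)\in C^{n-1}[a,b],\ f^{(n-1)}(\cdot)\in AC[a,b],\ f^{(n)}\in L_p(a,b)\bigr\},$$ where $f(\cdot)$ denotes a representative of the class $f$, and $AC[a,b]$ is the set of absolutely continuous functions on $[a,b]$. Then $D^n$ is a densely defined, unbounded, closed linear operator in $L_p(a,b)$. Furthermore, if the space $L_p(a,b)$ is complex, then $$\sigma(D^n)=\sigma_p(D^n)=\mathbb C,$$ and each $\lambda\in\mathbb C$ is an eigenvalue of $D^n$ of geometric multiplicity $n$, i.e. $\dim\ker(D^n-\lambda I)=n$. Here $\sigma(D^n)$ is the complement in $\mathbb C$ of the set of all $\lambda$ for which $D^n-\lambda I$ has an inverse that is a bounded linear operator defined on the whole space $L_p(a,b)$, and $\sigma_p(D^n)$ is the set of all eigenvalues of $D^n$. -/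

import Mathlib

open MeasureTheory Set
open scoped ENNReal

noncomputable section

namespace LpDerivative

/-- Lebesgue measure on the bounded interval `(a, b)`. -/
abbrev intervalMeasure (a b : ℝ) : Measure ℝ := volume.restrict (Ioo a b)

/-- The space `L_p(a, b)` of (classes of) `𝕜`-valued functions, `𝕜 = ℝ` or `𝕜 = ℂ`. -/
abbrev LpInterval (𝕜 : Type*) [RCLike 𝕜] (p : ℝ≥0∞) (a b : ℝ) : Type _ :=
  Lp 𝕜 p (intervalMeasure a b)

/-- For `n ≥ 1`: the function `g` is of class `C^{n-1}` on `[a, b]`, its derivative `g^{(n-1)}` is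
absolutely continuous on `[a, b]`, and `g^{(n)}`, which then exists almost everywhere on `(a, b)`,
belongs to `L_p(a, b)`. All derivatives are relative to `[a, b]`, i.e. one-sided at the end points;
`iteratedDerivWithin n g (Icc a b)` is the derivative of `iteratedDerivWithin (n - 1) g (Icc a b)`
where the latter is differentiable and takes the value `0` on the remaining null set. -/
structure IsSobolevRep {𝕜 : Type*} [RCLike 𝕜] (p : ℝ≥0∞) (a b : ℝ) (n : ℕ) (g : ℝ → 𝕜) :
    Prop where
  contDiffOn : ContDiffOn ℝ ((n - 1 : ℕ) : WithTop ℕ∞) g (Icc a b)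
  absCont : AbsolutelyContinuousOnInterval (iteratedDerivWithin (n - 1) g (Icc a b)) a b
  memLp : MemLp (iteratedDerivWithin n g (Icc a b)) p (intervalMeasure a b)

section Helpers

variable {𝕜 : Type*} [RCLike 𝕜] {p : ℝ≥0∞} {a b : ℝ} {n : ℕ}

/-- The derivative of an absolutely continuous function exists almost everywhere. -/
theorem IsSobolevRep.ae_differentiable {g : ℝ → 𝕜} (hab : a < b) (hg : IsSobolevRep p a b n g) :
    ∀ᵐ x ∂(intervalMeasure a b),
      DifferentiableWithinAt ℝ (iteratedDerivWithin (n - 1) g (Icc a b)) (Icc a b) x := by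
  have h := hg.absCont.boundedVariationOn
  rw [uIcc_of_le hab.le] at h
  have h2 := h.locallyBoundedVariationOn.ae_differentiableWithinAt_of_mem
  refine (ae_restrict_iff' measurableSet_Ioo).2 ?_
  filter_upwards [h2] with x hx hxI
  exact hx (Ioo_subset_Icc_self hxI)

theorem IsSobolevRep.eqOn_add {g h : ℝ → 𝕜} (hab : a < b) (hg : IsSobolevRep p a b n g)
    (hh : IsSobolevRep p a b n h) :
    EqOn (iteratedDerivWithin (n - 1) (g + h) (Icc a b))
      (iteratedDerivWithin (n - 1) g (Icc a b) + iteratedDerivWithin (n - 1) h (Icc a b))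
      (Icc a b) := fun _ hx =>
  iteratedDerivWithin_add hx (uniqueDiffOn_Icc hab) (hg.contDiffOn.contDiffWithinAt hx)
    (hh.contDiffOn.contDiffWithinAt hx)

/-- `(g + h)^{(n)} = g^{(n)} + h^{(n)}` almost everywhere. -/
theorem IsSobolevRep.ae_add {g h : ℝ → 𝕜} (hab : a < b) (hg : IsSobolevRep p a b n g)
    (hh : IsSobolevRep p a b n h) :
    iteratedDerivWithin n (g + h) (Icc a b) =ᵐ[intervalMeasure a b]
      iteratedDerivWithin n g (Icc a b) + iteratedDerivWithin n h (Icc a b) := by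
  filter_upwards [hg.ae_differentiable hab, hh.ae_differentiable hab,
    ae_restrict_mem (μ := volume) (measurableSet_Ioo (a := a) (b := b))] with x h1 h2 hx
  have hx' := Ioo_subset_Icc_self hx
  have key := hg.eqOn_add hab hh
  cases n with
  | zero => simp
  | succ m =>
    simp only [Nat.add_sub_cancel] at h1 h2 key
    rw [iteratedDerivWithin_succ, derivWithin_congr key (key hx'), derivWithin_add h1 h2,
      Pi.add_apply, iteratedDerivWithin_succ, iteratedDerivWithin_succ]

theorem AbsolutelyContinuousOnInterval_congr {f g : ℝ → 𝕜} (hfg : EqOn f g (uIcc a b))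
    (hf : AbsolutelyContinuousOnInterval f a b) : AbsolutelyContinuousOnInterval g a b := by
  rw [absolutelyContinuousOnInterval_iff] at hf ⊢
  intro ε hε
  obtain ⟨δ, hδ, H⟩ := hf ε hε
  refine ⟨δ, hδ, fun E hE hlt => ?_⟩
  have := H E hE hlt
  refine lt_of_eq_of_lt (Finset.sum_congr rfl fun i hi => ?_) this
  rw [hfg (hE.1 i hi).1, hfg (hE.1 i hi).2]

theorem IsSobolevRep.add {g h : ℝ → 𝕜} (hab : a < b) (hg : IsSobolevRep p a b n g)
    (hh : IsSobolevRep p a b n h) : IsSobolevRep p a b n (g + h) where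
  contDiffOn := hg.contDiffOn.add hh.contDiffOn
  absCont := AbsolutelyContinuousOnInterval_congr
    (by rw [uIcc_of_le hab.le]; exact (hg.eqOn_add hab hh).symm) (hg.absCont.add hh.absCont)
  memLp := (memLp_congr_ae (hg.ae_add hab hh)).2 (hg.memLp.add hh.memLp)

theorem iteratedDerivWithin_smul_const (k : ℕ) (c : 𝕜) (g : ℝ → 𝕜) :
    iteratedDerivWithin k (c • g) (Icc a b) = c • iteratedDerivWithin k g (Icc a b) := by
  funext x
  exact iteratedDerivWithin_const_smul_field c g

theorem IsSobolevRep.smul {g : ℝ → 𝕜} (c : 𝕜) (hg : IsSobolevRep p a b n g) :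
    IsSobolevRep p a b n (c • g) where
  contDiffOn := hg.contDiffOn.const_smul c
  absCont := by
    rw [iteratedDerivWithin_smul_const]
    exact hg.absCont.const_smul c
  memLp := by
    rw [iteratedDerivWithin_smul_const]
    exact hg.memLp.const_smul c

theorem IsSobolevRep.zero : IsSobolevRep p a b n (0 : ℝ → 𝕜) := by
  have h0 : ∀ k, iteratedDerivWithin k (0 : ℝ → 𝕜) (Icc a b) = 0 := fun k => by
    simpa using iteratedDerivWithin_smul_const (a := a) (b := b) k (0 : 𝕜) (0 : ℝ → 𝕜)
  refine ⟨contDiffOn_const, ?_, ?_⟩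
  · rw [h0, absolutelyContinuousOnInterval_iff]
    exact fun ε hε => ⟨1, one_pos, fun E _ _ => by simpa using hε⟩
  · rw [h0]
    exact MemLp.zero

theorem IsSobolevRep.continuousOn {g : ℝ → 𝕜} (hg : IsSobolevRep p a b n g) :
    ContinuousOn g (Icc a b) := hg.contDiffOn.continuousOn

/-- Two representatives of the same class coincide on `[a, b]`, so they have the same
derivatives. -/
theorem IsSobolevRep.ae_unique {g h : ℝ → 𝕜} (hab : a < b) (hg : IsSobolevRep p a b n g)
    (hh : IsSobolevRep p a b n h) (hgh : g =ᵐ[intervalMeasure a b] h) :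
    iteratedDerivWithin n g (Icc a b) =ᵐ[intervalMeasure a b]
      iteratedDerivWithin n h (Icc a b) := by
  have hEq : EqOn g h (Icc a b) := by
    refine Measure.eqOn_Icc_of_ae_eq volume hab.ne ?_ hg.continuousOn hh.continuousOn
    rwa [← restrict_Ioo_eq_restrict_Icc]
  filter_upwards [ae_restrict_mem (μ := volume) (measurableSet_Ioo (a := a) (b := b))] with x hx
  exact iteratedDerivWithin_congr hEq (Ioo_subset_Icc_self hx)

end Helpers

section Operator

variable (𝕜 : Type*) [RCLike 𝕜] (p : ℝ≥0∞) {a b : ℝ} (hab : a < b) (n : ℕ)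

/-- `W_p^n(a, b)` (`n ≥ 1`), as a subspace of `L_p(a, b)`: the classes having a representative `g`
with `g ∈ C^{n-1}[a, b]`, `g^{(n-1)} ∈ AC[a, b]` and `g^{(n)} ∈ L_p(a, b)`. -/
def sobolevSpace : Submodule 𝕜 (LpInterval 𝕜 p a b) where
  carrier := {f | ∃ g : ℝ → 𝕜, IsSobolevRep p a b n g ∧ f =ᵐ[intervalMeasure a b] g}
  zero_mem' := ⟨0, IsSobolevRep.zero, Lp.coeFn_zero _ _ _⟩
  add_mem' := by
    rintro f₁ f₂ ⟨g₁, hg₁, h₁⟩ ⟨g₂, hg₂, h₂⟩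
    exact ⟨g₁ + g₂, hg₁.add hab hg₂, (Lp.coeFn_add f₁ f₂).trans (h₁.add h₂)⟩
  smul_mem' := by
    rintro c f ⟨g, hg, h⟩
    exact ⟨c • g, hg.smul c, (Lp.coeFn_smul c f).trans (h.const_smul c)⟩

variable {𝕜 p n}

/-- The representative `f(·) ∈ C^{n-1}[a, b]` of an element of `W_p^n(a, b)`. -/
def sobolevRep (f : sobolevSpace 𝕜 p hab n) : ℝ → 𝕜 := f.2.choose

theorem isSobolevRep_sobolevRep (f : sobolevSpace 𝕜 p hab n) :
    IsSobolevRep p a b n (sobolevRep hab f) := f.2.choose_spec.1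

theorem ae_eq_sobolevRep (f : sobolevSpace 𝕜 p hab n) :
    (f : LpInterval 𝕜 p a b) =ᵐ[intervalMeasure a b] sobolevRep hab f := f.2.choose_spec.2

variable (𝕜 p n)

/-- The `n`th derivative operator `D^n f = f^{(n)}` (`n ≥ 1`) in `L_p(a, b)` with the maximal
domain `W_p^n(a, b)`. -/
def derivOp : LpInterval 𝕜 p a b →ₗ.[𝕜] LpInterval 𝕜 p a b where
  domain := sobolevSpace 𝕜 p hab n
  toFun :=
    { toFun := fun f => (isSobolevRep_sobolevRep hab f).memLp.toLp _
      map_add' := fun f₁ f₂ => by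
        have h₁ := isSobolevRep_sobolevRep hab f₁
        have h₂ := isSobolevRep_sobolevRep hab f₂
        rw [← MemLp.toLp_add, MemLp.toLp_eq_toLp_iff]
        refine ((isSobolevRep_sobolevRep hab (f₁ + f₂)).ae_unique hab (h₁.add hab h₂) ?_).trans
          (h₁.ae_add hab h₂)
        exact (ae_eq_sobolevRep hab (f₁ + f₂)).symm.trans ((Lp.coeFn_add _ _).trans
          ((ae_eq_sobolevRep hab f₁).add (ae_eq_sobolevRep hab f₂)))
      map_smul' := fun c f => by
        have h := isSobolevRep_sobolevRep hab f
        rw [RingHom.id_apply, ← MemLp.toLp_const_smul, MemLp.toLp_eq_toLp_iff,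
          ← iteratedDerivWithin_smul_const]
        refine (isSobolevRep_sobolevRep hab (c • f)).ae_unique hab (h.smul c) ?_
        exact (ae_eq_sobolevRep hab (c • f)).symm.trans ((Lp.coeFn_smul _ _).trans
          ((ae_eq_sobolevRep hab f).const_smul c)) }

/-- The value `D^n f` may be computed with any admissible representative of `f`. -/
theorem derivOp_apply_ae (f : (derivOp 𝕜 p hab n).domain) {g : ℝ → 𝕜}
    (hg : IsSobolevRep p a b n g) (hfg : (f : LpInterval 𝕜 p a b) =ᵐ[intervalMeasure a b] g) :
    derivOp 𝕜 p hab n f =ᵐ[intervalMeasure a b] iteratedDerivWithin n g (Icc a b) :=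
  (MemLp.coeFn_toLp (isSobolevRep_sobolevRep hab f).memLp).trans ((isSobolevRep_sobolevRep hab f).ae_unique hab hg
    ((ae_eq_sobolevRep hab f).symm.trans hfg))

end Operator

section Spectrum

variable {𝕜 X : Type*} [RCLike 𝕜] [NormedAddCommGroup X] [NormedSpace 𝕜 X]

/-- A (not necessarily everywhere defined) linear operator is bounded if `‖A x‖ ≤ C ‖x‖` on its
domain, for some constant `C`. -/
def IsBoundedOp (A : X →ₗ.[𝕜] X) : Prop :=
  ∃ C : ℝ, ∀ x : A.domain, ‖A x‖ ≤ C * ‖(x : X)‖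

/-- The resolvent set `ρ(A)`: the `μ` such that `A - μ I : D(A) → X` has an inverse
`R : X → D(A)` which is a bounded linear operator on `X`. -/
def resolventSet (A : X →ₗ.[𝕜] X) : Set 𝕜 :=
  {μ | ∃ R : X →L[𝕜] X,
    (∀ y : X, ∃ h : R y ∈ A.domain, A ⟨R y, h⟩ - μ • R y = y) ∧
    (∀ x : A.domain, R (A x - μ • (x : X)) = x)}

/-- The spectrum `σ(A)`, the complement of the resolvent set. -/
def spectrum (A : X →ₗ.[𝕜] X) : Set 𝕜 := (resolventSet A)ᶜ

/-- The eigenspace `ker (A - μ I)`, a subspace of `X`. -/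
def eigenspace (A : X →ₗ.[𝕜] X) (μ : 𝕜) : Submodule 𝕜 X :=
  (LinearMap.ker (A.toFun - μ • A.domain.subtype)).map A.domain.subtype

theorem mem_eigenspace_iff (A : X →ₗ.[𝕜] X) (μ : 𝕜) (x : X) :
    x ∈ eigenspace A μ ↔ ∃ h : x ∈ A.domain, A ⟨x, h⟩ = μ • x := by
  simp only [eigenspace, Submodule.mem_map, LinearMap.mem_ker, LinearMap.sub_apply,
    LinearMap.smul_apply, Submodule.subtype_apply, sub_eq_zero]
  constructor
  · rintro ⟨y, hy, rfl⟩
    exact ⟨y.2, hy⟩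
  · rintro ⟨h, hx⟩
    exact ⟨⟨x, h⟩, hx, rfl⟩

/-- The point spectrum `σ_p(A)`: the set of eigenvalues of `A`. -/
def pointSpectrum (A : X →ₗ.[𝕜] X) : Set 𝕜 :=
  {μ | ∃ x : A.domain, (x : X) ≠ 0 ∧ A x = μ • (x : X)}

end Spectrum

end LpDerivative

end

/-!
The proof rests on the Volterra operator `V f (x) = ∫ t in a..x, f t` on `L_p(a, b)`. By the
fundamental theorem of calculus for absolutely continuous functions, iterated `n` times, `h = D^n f`
holds if and only if `f - V^n h` is a polynomial of degree less than `n`, that is, lies in the span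
`N` of `1, V 1, …, V^(n-1) 1` (`mem_graph_derivOp_iff_mem_iterateSpan`). The space `N` has dimension
`n`, because `V` is injective and `1` is not in its range (`rank_iterateSpan`).

All the assertions except density follow from this description of the graph and from the
quasinilpotency of `V` (`isQuasinilpotent_volterra`), a consequence of the bound
`|V^(k+1) f (x)| ≤ (x - a)^k / k! * ‖f‖₁`:

* the graph is the preimage of the closed subspace `N` under the continuous map
  `(f, h) ↦ f - V^n h`, so `D^n` is closed;
* `D^n V^n = 1`, so a bound for `D^n` would bound the quasinilpotent operator `V^n` below;
* `D^n f = μ f` means `(1 - μ V^n) f ∈ N`, and `1 - μ V^n` is invertible, so the eigenspace of every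
  `μ` is isomorphic to `N`. Every `μ` is thus an eigenvalue, and the spectrum is the whole field.

The domain is dense because it contains the compactly supported smooth functions.
-/

namespace LpDerivative

open Filter Topology

/-! ### Operators inverted by a quasinilpotent operator modulo a finite-dimensional kernel -/

section Abstract

variable {𝕜 X : Type*} [RCLike 𝕜] [NormedAddCommGroup X] [NormedSpace 𝕜 X]

/-- The linear span of `e, V e, …, V ^ (n - 1) e`, built recursively. -/
def iterateSpan (V : X →L[𝕜] X) (e : X) : ℕ → Submodule 𝕜 X
  | 0 => ⊥
  | n + 1 => (𝕜 ∙ e) ⊔ (iterateSpan V e n).map (V : X →ₗ[𝕜] X)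

/-- As `e` is not in the range of `V` and `V` is injective, `e, V e, …, V ^ (n - 1) e` are linearly
independent. -/
theorem rank_iterateSpan {V : X →L[𝕜] X} {e : X} (hV : Function.Injective V)
    (he : ∀ x, V x ≠ e) (n : ℕ) : Module.rank 𝕜 (iterateSpan V e n) = n := by
  induction n with
  | zero => rw [iterateSpan, rank_bot, Nat.cast_zero]
  | succ n ih =>
    have he0 : e ≠ 0 := fun h => he 0 (by rw [map_zero, h])
    have hdisj : (𝕜 ∙ e) ⊓ (iterateSpan V e n).map (V : X →ₗ[𝕜] X) = ⊥ := by
      rw [eq_bot_iff]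
      rintro x ⟨hx, y, -, rfl⟩
      obtain ⟨c, hc⟩ := Submodule.mem_span_singleton.1 hx
      rcases eq_or_ne c 0 with rfl | hc0
      · rw [zero_smul] at hc
        exact hc.symm
      · refine absurd ?_ (he (c⁻¹ • y))
        rw [map_smul]
        change c⁻¹ • ((V : X →ₗ[𝕜] X) y) = e
        rw [← hc, inv_smul_smul₀ hc0]
    have h := Submodule.rank_sup_add_rank_inf_eq (𝕜 ∙ e)
      ((iterateSpan V e n).map (V : X →ₗ[𝕜] X))
    have h1 : Module.rank 𝕜 (𝕜 ∙ e) = 1 := by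
      rw [rank_submodule_eq_one_iff]
      exact ⟨e, Submodule.mem_span_singleton_self e, he0, le_rfl⟩
    have h2 : Module.rank 𝕜 ((iterateSpan V e n).map (V : X →ₗ[𝕜] X)) = n := by
      rw [← ih]
      exact ((Submodule.equivMapOfInjective _ hV _).rank_eq).symm
    rw [hdisj, h1, h2, rank_bot, add_zero] at h
    rw [iterateSpan, h, Nat.cast_succ, add_comm]

/-- `V` is quasinilpotent: its powers decay faster than every geometric sequence. -/
def IsQuasinilpotent (V : X →L[𝕜] X) : Prop :=
  ∀ C : ℝ, 0 ≤ C → Tendsto (fun k : ℕ => C ^ k * ‖V ^ k‖) atTop (𝓝 0)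

theorem IsQuasinilpotent.pow {V : X →L[𝕜] X} (hV : IsQuasinilpotent V) {n : ℕ} (hn : 1 ≤ n) :
    IsQuasinilpotent (V ^ n) := by
  intro C hC
  have h1 : (1 : ℝ) ≤ max C 1 := le_max_right _ _
  have hsub : Tendsto (fun k : ℕ => n * k) atTop atTop :=
    tendsto_id.const_mul_atTop' hn
  refine squeeze_zero (fun k => by positivity) (fun k => ?_)
    ((hV (max C 1) (zero_le_one.trans h1)).comp hsub)
  rw [← pow_mul]
  refine mul_le_mul_of_nonneg_right ?_ (norm_nonneg _)
  exact (pow_le_pow_left₀ hC (le_max_left _ _) k).trans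
    (pow_le_pow_right₀ h1 (Nat.le_mul_of_pos_left k hn))

/-- A quasinilpotent operator has no nonzero spectral value: `1 - (c V) ^ k` is invertible for large
`k` by the Neumann series, and it is a multiple of `1 - c V`. -/
theorem IsQuasinilpotent.isUnit_one_sub_smul [CompleteSpace X] {V : X →L[𝕜] X}
    (hV : IsQuasinilpotent V) (c : 𝕜) : IsUnit (1 - c • V) := by
  obtain ⟨k, hk⟩ := ((hV ‖c‖ (norm_nonneg c)).eventually_lt_const one_pos).exists
  have hu : IsUnit (1 - (c • V) ^ k) := by
    refine isUnit_one_sub_of_norm_lt_one ?_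
    rwa [smul_pow, norm_smul, norm_pow]
  rw [← mul_neg_geom_sum] at hu
  have hc : Commute (1 - c • V) (∑ i ∈ Finset.range k, (c • V) ^ i) := by
    rw [Commute, SemiconjBy, mul_neg_geom_sum, geom_sum_mul_neg]
  exact (hc.isUnit_mul_iff.1 hu).1

/-- Iterating `‖x‖ ≤ C ‖V x‖` gives `‖x‖ ≤ C ^ k ‖V ^ k‖ ‖x‖`, whose right side tends to `0`. -/
theorem IsQuasinilpotent.not_boundedBelow [Nontrivial X] {V : X →L[𝕜] X}
    (hV : IsQuasinilpotent V) (C : ℝ) : ¬ ∀ x, ‖x‖ ≤ C * ‖V x‖ := by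
  intro h
  obtain ⟨x, hx⟩ := exists_ne (0 : X)
  have h' : ∀ x, ‖x‖ ≤ max C 0 * ‖V x‖ := fun x =>
    (h x).trans (mul_le_mul_of_nonneg_right (le_max_left _ _) (norm_nonneg _))
  have hC : 0 ≤ max C 0 := le_max_right _ _
  have hk : ∀ k : ℕ, ‖x‖ ≤ max C 0 ^ k * ‖(V ^ k) x‖ := by
    intro k
    induction k with
    | zero => simp
    | succ k ih =>
      refine ih.trans ?_
      rw [pow_succ, mul_assoc, pow_succ' V]
      exact mul_le_mul_of_nonneg_left (h' _) (pow_nonneg hC k)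
  obtain ⟨k, hk1⟩ := ((hV _ hC).eventually_lt_const one_pos).exists
  have : ‖x‖ ≤ (max C 0 ^ k * ‖V ^ k‖) * ‖x‖ := by
    rw [mul_assoc]
    exact (hk k).trans (mul_le_mul_of_nonneg_left ((V ^ k).le_opNorm x) (pow_nonneg hC k))
  have hx0 := norm_pos_iff.2 hx
  nlinarith

variable {A : X →ₗ.[𝕜] X} {T : X →L[𝕜] X} {N : Submodule 𝕜 X}

/-- An operator with a bounded right inverse `T` and finite-dimensional kernel `N` is closed: its
graph is the preimage of the closed subspace `N` under `(f, h) ↦ f - T h`. -/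
theorem isClosed_of_mem_graph_iff [FiniteDimensional 𝕜 N]
    (hA : ∀ f h, (f, h) ∈ A.graph ↔ f - T h ∈ N) : A.IsClosed := by
  have : (A.graph : Set (X × X)) = (fun q : X × X => q.1 - T q.2) ⁻¹' (N : Set X) := by
    ext ⟨f, h⟩
    exact hA f h
  rw [LinearPMap.IsClosed, this]
  exact (Submodule.closed_of_finiteDimensional N).preimage (by fun_prop)

/-- Since `A T h = h`, a bound for `A` would bound `T` below. -/
theorem not_isBoundedOp_of_mem_graph_iff [Nontrivial X] (hT : IsQuasinilpotent T)
    (hA : ∀ f h, (f, h) ∈ A.graph ↔ f - T h ∈ N) : ¬ IsBoundedOp A := by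
  rintro ⟨C, hC⟩
  refine hT.not_boundedBelow C fun h => ?_
  have hg : (T h, h) ∈ A.graph := (hA _ _).2 (by simp)
  obtain ⟨y, hy1, hy2⟩ := (LinearPMap.mem_graph_iff A).1 hg
  have := hC y
  rwa [hy1, hy2] at this

/-- The equation `A f = μ f` means `(1 - μ T) f ∈ N`, and `1 - μ T` is invertible. -/
theorem rank_eigenspace_of_mem_graph_iff [CompleteSpace X] (hT : IsQuasinilpotent T)
    (hA : ∀ f h, (f, h) ∈ A.graph ↔ f - T h ∈ N) (μ : 𝕜) :
    Module.rank 𝕜 (eigenspace A μ) = Module.rank 𝕜 N := by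
  obtain ⟨u, hu⟩ := hT.isUnit_one_sub_smul μ
  let e : X ≃L[𝕜] X := ContinuousLinearEquiv.unitsEquiv 𝕜 X u
  have he : ∀ x, e x = x - μ • T x := fun x => by
    change (u : X →L[𝕜] X) x = _
    rw [hu]
    rfl
  have h : eigenspace A μ = N.comap (e.toLinearEquiv : X →ₗ[𝕜] X) := by
    ext x
    rw [mem_eigenspace_iff, Submodule.mem_comap]
    change _ ↔ e x ∈ N
    rw [he, ← map_smul, ← hA, LinearPMap.mem_graph_iff]
    constructor
    · rintro ⟨hx, h⟩
      exact ⟨⟨x, hx⟩, rfl, h⟩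
    · rintro ⟨y, rfl, h⟩
      exact ⟨y.2, h⟩
  rw [h]
  exact (LinearEquiv.ofSubmodule' e.toLinearEquiv N).rank_eq

theorem mem_pointSpectrum_of_eigenspace_ne_bot {μ : 𝕜} (h : eigenspace A μ ≠ ⊥) :
    μ ∈ pointSpectrum A := by
  obtain ⟨x, hx, hx0⟩ := Submodule.exists_mem_ne_zero_of_ne_bot h
  obtain ⟨hd, hA⟩ := (mem_eigenspace_iff A μ x).1 hx
  exact ⟨⟨x, hd⟩, hx0, hA⟩

theorem pointSpectrum_subset_spectrum (A : X →ₗ.[𝕜] X) : pointSpectrum A ⊆ spectrum A := by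
  rintro μ ⟨x, hx0, hx⟩ ⟨R, -, hR⟩
  have := hR x
  rw [hx, sub_self, map_zero] at this
  exact hx0 this.symm

end Abstract

/-! ### The Volterra operator on `L_p(a, b)` -/

section Volterra

variable {𝕜 : Type*} [RCLike 𝕜] {p : ℝ≥0∞} {a b : ℝ}

/-- The primitive `x ↦ ∫ t in a..x, f t`. -/
noncomputable def primitive (a : ℝ) (f : ℝ → 𝕜) (x : ℝ) : 𝕜 := ∫ t in a..x, f t

theorem intervalIntegrable_of_integrable (hab : a ≤ b) {f : ℝ → 𝕜}
    (hf : Integrable f (intervalMeasure a b)) : IntervalIntegrable f volume a b := by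
  rwa [intervalIntegrable_iff_integrableOn_Ioo_of_le hab]

theorem intervalIntegrable_left {f : ℝ → 𝕜} (hf : Integrable f (intervalMeasure a b))
    {x : ℝ} (hx : x ∈ Icc a b) : IntervalIntegrable f volume a x := by
  rw [intervalIntegrable_iff_integrableOn_Ioo_of_le hx.1]
  exact IntegrableOn.mono_set hf (Ioo_subset_Ioo_right hx.2)

theorem primitive_congr {f g : ℝ → 𝕜} (h : f =ᵐ[intervalMeasure a b] g) {x : ℝ}
    (hx : x ∈ Icc a b) : primitive a f x = primitive a g x := by
  rw [primitive, primitive, intervalIntegral.integral_of_le hx.1,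
    intervalIntegral.integral_of_le hx.1, integral_Ioc_eq_integral_Ioo,
    integral_Ioc_eq_integral_Ioo]
  exact integral_congr_ae (ae_mono (Measure.restrict_mono (Ioo_subset_Ioo_right hx.2) le_rfl) h)

theorem continuousOn_primitive (hab : a ≤ b) {f : ℝ → 𝕜}
    (hf : Integrable f (intervalMeasure a b)) : ContinuousOn (primitive a f) (Icc a b) := by
  have := intervalIntegral.continuousOn_primitive_interval'
    (intervalIntegrable_of_integrable hab hf) left_mem_uIcc
  rwa [uIcc_of_le hab] at this

theorem memLp_of_continuousOn {g : ℝ → 𝕜} (hg : ContinuousOn g (Icc a b)) :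
    MemLp g p (intervalMeasure a b) := by
  obtain ⟨C, hC⟩ := isCompact_Icc.exists_bound_of_continuousOn hg
  refine MemLp.of_bound
    ((hg.mono Ioo_subset_Icc_self).aestronglyMeasurable measurableSet_Ioo) C ?_
  filter_upwards [ae_restrict_mem (μ := volume) (measurableSet_Ioo (a := a) (b := b))] with x hx
  exact hC x (Ioo_subset_Icc_self hx)

theorem norm_primitive_le {f : ℝ → 𝕜} (hf : Integrable f (intervalMeasure a b)) {x : ℝ}
    (hx : x ∈ Icc a b) : ‖primitive a f x‖ ≤ ∫ t, ‖f t‖ ∂(intervalMeasure a b) := by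
  rw [primitive, intervalIntegral.integral_of_le hx.1, integral_Ioc_eq_integral_Ioo]
  exact (norm_integral_le_integral_norm _).trans
    (integral_mono_measure (Measure.restrict_mono (Ioo_subset_Ioo_right hx.2) le_rfl)
      (Eventually.of_forall fun t => norm_nonneg _) hf.norm)

theorem norm_le_of_bound {f : LpInterval 𝕜 p a b} {g : ℝ → 𝕜}
    (hfg : f =ᵐ[intervalMeasure a b] g) {C : ℝ} (hC : 0 ≤ C) (hg : ∀ x ∈ Icc a b, ‖g x‖ ≤ C) :
    ‖f‖ ≤ ((measureUnivNNReal (intervalMeasure a b) : ℝ) ^ p.toReal⁻¹) * C := by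
  have := Lp.norm_le_of_ae_bound (f := f) hC ?_
  · exact this
  · filter_upwards [hfg, ae_restrict_mem (μ := volume) (measurableSet_Ioo (a := a) (b := b))]
      with x hx hxI
    rw [hx]
    exact hg x (Ioo_subset_Icc_self hxI)

variable (𝕜 p a b) in
/-- The constant function `1` as an element of `L_p(a, b)`. -/
noncomputable def oneLp : LpInterval 𝕜 p a b := (memLp_const (1 : 𝕜)).toLp (fun _ => (1 : 𝕜))

theorem oneLp_ae : oneLp 𝕜 p a b =ᵐ[intervalMeasure a b] fun _ => (1 : 𝕜) := MemLp.coeFn_toLp _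

variable [hp1 : Fact (1 ≤ p)]

theorem integrable_lp (f : LpInterval 𝕜 p a b) : Integrable f (intervalMeasure a b) :=
  (Lp.memLp f).integrable hp1.out

theorem memLp_primitive (hab : a < b) (f : LpInterval 𝕜 p a b) :
    MemLp (primitive a f) p (intervalMeasure a b) :=
  memLp_of_continuousOn (continuousOn_primitive hab.le (integrable_lp f))

/-- On the bounded interval, `L_p` embeds continuously into `L_1`. -/
theorem exists_integral_norm_le (𝕜 : Type*) [RCLike 𝕜] (p : ℝ≥0∞) [hp1 : Fact (1 ≤ p)]
    (a b : ℝ) : ∃ M : ℝ, 0 ≤ M ∧ ∀ f : LpInterval 𝕜 p a b,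
      ∫ t, ‖f t‖ ∂(intervalMeasure a b) ≤ M * ‖f‖ := by
  have hfin : intervalMeasure a b univ ^ (1 / (1 : ℝ≥0∞).toReal - 1 / p.toReal) ≠ ∞ := by
    refine ENNReal.rpow_ne_top_of_nonneg ?_ (measure_ne_top _ _)
    rcases eq_or_ne p ∞ with rfl | hp
    · simp
    · rw [sub_nonneg, ENNReal.toReal_one, div_one]
      exact div_le_one_of_le₀ (by simpa using ENNReal.toReal_mono hp hp1.out) (by positivity)
  refine ⟨(intervalMeasure a b univ ^ (1 / (1 : ℝ≥0∞).toReal - 1 / p.toReal)).toReal,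
    ENNReal.toReal_nonneg, fun f => ?_⟩
  have h := eLpNorm_le_eLpNorm_mul_rpow_measure_univ hp1.out (Lp.aestronglyMeasurable f)
  rw [integral_norm_eq_lintegral_enorm (Lp.aestronglyMeasurable f), ← eLpNorm_one_eq_lintegral_enorm,
    Lp.norm_def, mul_comm, ← ENNReal.toReal_mul]
  exact ENNReal.toReal_mono (ENNReal.mul_ne_top (Lp.eLpNorm_ne_top f) hfin) h

variable (𝕜 p) in
/-- The Volterra operator, taking `f` to the class of `x ↦ ∫ t in a..x, f t`, on `L_p(a, b)`. -/
noncomputable def volterra (hab : a < b) : LpInterval 𝕜 p a b →L[𝕜] LpInterval 𝕜 p a b :=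
  LinearMap.mkContinuousOfExistsBound
    { toFun := fun f => (memLp_primitive hab f).toLp (primitive a f)
      map_add' := fun f g => by
        rw [← MemLp.toLp_add, MemLp.toLp_eq_toLp_iff]
        filter_upwards [ae_restrict_mem (μ := volume) (measurableSet_Ioo (a := a) (b := b))]
          with x hx
        have hx' := Ioo_subset_Icc_self hx
        rw [primitive_congr (Lp.coeFn_add f g) hx', Pi.add_apply]
        exact intervalIntegral.integral_add (intervalIntegrable_left (integrable_lp f) hx')
          (intervalIntegrable_left (integrable_lp g) hx')
      map_smul' := fun c f => by
        rw [RingHom.id_apply, ← MemLp.toLp_const_smul, MemLp.toLp_eq_toLp_iff]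
        filter_upwards [ae_restrict_mem (μ := volume) (measurableSet_Ioo (a := a) (b := b))]
          with x hx
        rw [primitive_congr (Lp.coeFn_smul c f) (Ioo_subset_Icc_self hx), Pi.smul_apply]
        exact intervalIntegral.integral_smul c _ }
    (by
      obtain ⟨M, hM0, hM⟩ := exists_integral_norm_le 𝕜 p a b
      refine ⟨((measureUnivNNReal (intervalMeasure a b) : ℝ) ^ p.toReal⁻¹) * M, fun f => ?_⟩
      rw [mul_assoc]
      exact norm_le_of_bound (MemLp.coeFn_toLp (memLp_primitive hab f)) (by positivity)
        fun x hx => (norm_primitive_le (integrable_lp f) hx).trans (hM f))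

theorem volterra_ae (hab : a < b) (f : LpInterval 𝕜 p a b) :
    volterra 𝕜 p hab f =ᵐ[intervalMeasure a b] primitive a f :=
  MemLp.coeFn_toLp (memLp_primitive hab f)

/-- The pointwise bound `|V ^ (k + 1) f (x)| ≤ (x - a) ^ k / k! * ‖f‖₁`. -/
theorem exists_volterra_pow_rep (hab : a < b) (f : LpInterval 𝕜 p a b) (k : ℕ) :
    ∃ g : ℝ → 𝕜, (volterra 𝕜 p hab ^ (k + 1)) f =ᵐ[intervalMeasure a b] g ∧
      ∀ x ∈ Icc a b, ‖g x‖ ≤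
        (x - a) ^ k / k.factorial * ∫ t, ‖f t‖ ∂(intervalMeasure a b) := by
  induction k with
  | zero =>
    refine ⟨primitive a f, by simpa using volterra_ae hab f, fun x hx => ?_⟩
    simpa using norm_primitive_le (integrable_lp f) hx
  | succ k ih =>
    obtain ⟨g, hg, hb⟩ := ih
    refine ⟨primitive a ((volterra 𝕜 p hab ^ (k + 1)) f), ?_, fun x hx => ?_⟩
    · rw [pow_succ' _ (k + 1)]
      exact volterra_ae hab _
    rw [primitive_congr hg hx, primitive]
    set I := ∫ t, ‖f t‖ ∂(intervalMeasure a b)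
    have hint : ∫ t in a..x, (t - a) ^ k / k.factorial * I
        = (x - a) ^ (k + 1) / (k + 1).factorial * I := by
      rw [intervalIntegral.integral_mul_const, intervalIntegral.integral_div,
        intervalIntegral.integral_comp_sub_right (fun t => t ^ k) a, integral_pow,
        Nat.factorial_succ]
      push_cast
      simp only [sub_self, zero_pow (Nat.succ_ne_zero k), sub_zero]
      rw [div_div]
    rw [← hint]
    refine intervalIntegral.norm_integral_le_of_norm_le hx.1
      (Eventually.of_forall fun t ht => hb t ⟨ht.1.le, ht.2.trans hx.2⟩) ?_
    exact Continuous.intervalIntegrable (by fun_prop) _ _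

theorem isQuasinilpotent_volterra (hab : a < b) : IsQuasinilpotent (volterra 𝕜 p hab) := by
  intro C hC
  obtain ⟨M, hM0, hM⟩ := exists_integral_norm_le 𝕜 p a b
  set m : ℝ := (measureUnivNNReal (intervalMeasure a b) : ℝ) ^ p.toReal⁻¹
  have hm : 0 ≤ m := by positivity
  -- The pointwise bound starts at the first power of `V`.
  rw [← tendsto_add_atTop_iff_nat 1]
  have hlim : Tendsto (fun k : ℕ => C * m * M * ((C * (b - a)) ^ k / k.factorial)) atTop (𝓝 0) := by
    simpa using (FloorSemiring.tendsto_pow_div_factorial_atTop (C * (b - a))).const_mul (C * m * M)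
  refine squeeze_zero (fun k => by positivity) (fun k => ?_) hlim
  have hba : 0 ≤ b - a := sub_nonneg.2 hab.le
  have hnorm : ‖volterra 𝕜 p hab ^ (k + 1)‖ ≤ m * ((b - a) ^ k / k.factorial * M) := by
    refine ContinuousLinearMap.opNorm_le_bound _ (by positivity) fun f => ?_
    obtain ⟨g, hg, hb⟩ := exists_volterra_pow_rep hab f k
    rw [mul_assoc, mul_assoc]
    refine norm_le_of_bound hg (by positivity) fun x hx => (hb x hx).trans ?_
    have hxa : 0 ≤ x - a := sub_nonneg.2 hx.1
    have hxb : x - a ≤ b - a := sub_le_sub_right hx.2 a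
    gcongr
    exact hM f
  calc C ^ (k + 1) * ‖volterra 𝕜 p hab ^ (k + 1)‖
      ≤ C ^ (k + 1) * (m * ((b - a) ^ k / k.factorial * M)) := by gcongr
    _ = C * m * M * ((C * (b - a)) ^ k / k.factorial) := by rw [mul_pow]; ring

/-- Lebesgue differentiation of the primitive. -/
theorem ae_hasDerivAt_primitive (hab : a < b) {f : ℝ → 𝕜}
    (hf : Integrable f (intervalMeasure a b)) :
    ∀ᵐ x, x ∈ Icc a b → HasDerivAt (primitive a f) (f x) x := by
  filter_upwards [(intervalIntegrable_of_integrable hab.le hf).ae_hasDerivAt_integral] with x hx hxI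
  rw [uIcc_of_le hab.le] at hx
  exact hx hxI a (left_mem_Icc.2 hab.le)

/-- By Lebesgue differentiation, `f` is recovered almost everywhere from its primitive. -/
theorem volterra_injective (hab : a < b) : Function.Injective (volterra 𝕜 p hab) := by
  rw [injective_iff_map_eq_zero]
  intro f hf
  have h0 : EqOn (primitive a f) 0 (Icc a b) := by
    refine Measure.eqOn_Icc_of_ae_eq volume hab.ne ?_
      (continuousOn_primitive hab.le (integrable_lp f)) continuousOn_const
    rw [← restrict_Ioo_eq_restrict_Icc]
    refine (volterra_ae hab f).symm.trans ?_
    rw [hf]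
    exact Lp.coeFn_zero _ _ _
  rw [Lp.eq_zero_iff_ae_eq_zero]
  refine (ae_restrict_iff' measurableSet_Ioo).2 ?_
  filter_upwards [ae_hasDerivAt_primitive hab (integrable_lp f)] with x hx hxI
  have h1 := hx (Ioo_subset_Icc_self hxI)
  have h2 : primitive a f =ᶠ[𝓝 x] 0 :=
    h0.eventuallyEq_of_mem (Icc_mem_nhds hxI.1 hxI.2)
  exact h1.unique ((hasDerivAt_const x (0 : 𝕜)).congr_of_eventuallyEq h2)

/-- A primitive vanishes at `a`, so it cannot be the constant `1`. -/
theorem volterra_ne_oneLp (hab : a < b) (f : LpInterval 𝕜 p a b) :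
    volterra 𝕜 p hab f ≠ oneLp 𝕜 p a b := by
  intro hf
  have h1 : EqOn (primitive a f) (fun _ => 1) (Icc a b) := by
    refine Measure.eqOn_Icc_of_ae_eq volume hab.ne ?_
      (continuousOn_primitive hab.le (integrable_lp f)) continuousOn_const
    rw [← restrict_Ioo_eq_restrict_Icc]
    refine (volterra_ae hab f).symm.trans ?_
    rw [hf]
    exact oneLp_ae
  have := h1 (left_mem_Icc.2 hab.le)
  simp [primitive] at this

end Volterra

/-! ### The graph of `D^n` -/

section Sobolev

variable {𝕜 : Type*} [RCLike 𝕜] {p : ℝ≥0∞} {a b : ℝ}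

/-- The increments of the primitive of `f` are dominated by those of the primitive of `‖f‖`, which
reduces the claim to real-valued functions. -/
theorem absolutelyContinuousOnInterval_primitive (hab : a < b) {f : ℝ → 𝕜}
    (hf : Integrable f (intervalMeasure a b)) :
    AbsolutelyContinuousOnInterval (primitive a f) a b := by
  have hF := (intervalIntegrable_of_integrable hab.le hf).norm
    |>.absolutelyContinuousOnInterval_intervalIntegral (c := a) left_mem_uIcc
  rw [absolutelyContinuousOnInterval_iff] at hF ⊢
  intro ε hε
  obtain ⟨δ, hδ, H⟩ := hF ε hε
  refine ⟨δ, hδ, fun E hE hlt => lt_of_le_of_lt (Finset.sum_le_sum fun i hi => ?_) (H E hE hlt)⟩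
  have h1 := (hE.1 i hi).1
  have h2 := (hE.1 i hi).2
  rw [uIcc_of_le hab.le] at h1 h2
  have i1 := intervalIntegrable_left hf h1
  have i2 := intervalIntegrable_left hf h2
  rw [dist_eq_norm, dist_eq_norm, primitive, primitive,
    intervalIntegral.integral_interval_sub_left i1 i2,
    intervalIntegral.integral_interval_sub_left i1.norm i2.norm, Real.norm_eq_abs]
  exact intervalIntegral.norm_integral_le_abs_integral_norm

/-- The fundamental theorem of calculus: `g` minus a primitive of its derivative is absolutely
continuous with derivative zero almost everywhere, hence constant. -/
theorem IsSobolevRep.eq_add_primitive (hab : a < b) {g u : ℝ → 𝕜} (hg : IsSobolevRep p a b 1 g)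
    (hu : Integrable u (intervalMeasure a b))
    (hgu : u =ᵐ[intervalMeasure a b] iteratedDerivWithin 1 g (Icc a b)) :
    ∃ c : 𝕜, ∀ x ∈ Icc a b, g x = c + primitive a u x := by
  have hac : AbsolutelyContinuousOnInterval g a b := by simpa using hg.absCont
  have hd := hac.sub (absolutelyContinuousOnInterval_primitive hab hu)
  obtain ⟨c, hc⟩ := hd.const_of_ae_hasDerivAt_zero <| by
    have h1 := (ae_restrict_iff' measurableSet_Ioo).1 (hg.ae_differentiable hab)
    have h2 := (ae_restrict_iff' measurableSet_Ioo).1 hgu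
    have ha : ∀ᵐ x : ℝ, x ≠ a := by simp [ae_iff, measure_singleton]
    have hb : ∀ᵐ x : ℝ, x ≠ b := by simp [ae_iff, measure_singleton]
    filter_upwards [h1, h2, ha, hb, ae_hasDerivAt_primitive hab hu] with x h1 h2 ha hb h3 hx
    rw [uIcc_of_le hab.le] at hx
    have hxo : x ∈ Ioo a b := ⟨lt_of_le_of_ne hx.1 ha.symm, lt_of_le_of_ne hx.2 hb⟩
    have h1' := (h1 hxo).hasDerivWithinAt.hasDerivAt (Icc_mem_nhds hxo.1 hxo.2)
    simp only [Nat.sub_self, iteratedDerivWithin_zero] at h1'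
    have h2' := h2 hxo
    rw [iteratedDerivWithin_one] at h2'
    rw [← h2'] at h1'
    simpa using h1'.sub (h3 hx)
  refine ⟨c, fun x hx => ?_⟩
  rw [uIcc_of_le hab.le] at hc
  rw [← hc x hx, Pi.sub_apply, sub_add_cancel]

/-- The converse of `IsSobolevRep.eq_add_primitive`, by Lebesgue differentiation. -/
theorem isSobolevRep_one_const_add_primitive (hab : a < b) (c : 𝕜) {u : ℝ → 𝕜}
    (hu : Integrable u (intervalMeasure a b)) (hup : MemLp u p (intervalMeasure a b)) :
    IsSobolevRep p a b 1 (fun x => c + primitive a u x) ∧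
      u =ᵐ[intervalMeasure a b]
        iteratedDerivWithin 1 (fun x => c + primitive a u x) (Icc a b) := by
  have hae : u =ᵐ[intervalMeasure a b]
      iteratedDerivWithin 1 (fun x => c + primitive a u x) (Icc a b) := by
    refine (ae_restrict_iff' measurableSet_Ioo).2 ?_
    filter_upwards [ae_hasDerivAt_primitive hab hu] with x hx hxI
    have hxI' := Ioo_subset_Icc_self hxI
    rw [iteratedDerivWithin_one]
    exact (((hx hxI').const_add c).hasDerivWithinAt.derivWithin
      (uniqueDiffOn_Icc hab x hxI')).symm
  refine ⟨⟨?_, ?_, (memLp_congr_ae hae).1 hup⟩, hae⟩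
  · simpa using! continuousOn_const.add (continuousOn_primitive hab.le hu)
  · have hc : AbsolutelyContinuousOnInterval (fun _ : ℝ => c) a b :=
      contDiffOn_const.absolutelyContinuousOnInterval
    simpa using! hc.add (absolutelyContinuousOnInterval_primitive hab hu)

theorem isSobolevRep_succ_iff (hab : a < b) {n : ℕ} (hn : 1 ≤ n) {g : ℝ → 𝕜} :
    IsSobolevRep p a b (n + 1) g ↔
      DifferentiableOn ℝ g (Icc a b) ∧ IsSobolevRep p a b n (derivWithin g (Icc a b)) := by
  obtain ⟨m, rfl⟩ : ∃ m, n = m + 1 := ⟨n - 1, by omega⟩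
  have hcd : ContDiffOn ℝ ((m + 1 : ℕ) : WithTop ℕ∞) g (Icc a b) ↔
      DifferentiableOn ℝ g (Icc a b) ∧
        ContDiffOn ℝ (m : WithTop ℕ∞) (derivWithin g (Icc a b)) (Icc a b) := by
    rw [Nat.cast_add, Nat.cast_one, contDiffOn_succ_iff_derivWithin (uniqueDiffOn_Icc hab)]
    simp
  constructor
  · rintro ⟨h1, h2, h3⟩
    simp only [Nat.add_sub_cancel] at h1 h2
    rw [iteratedDerivWithin_succ'] at h2 h3
    exact ⟨(hcd.1 h1).1, (hcd.1 h1).2, h2, h3⟩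
  · rintro ⟨h0, h1, h2, h3⟩
    simp only [Nat.add_sub_cancel] at h1 h2
    rw [← iteratedDerivWithin_succ'] at h2 h3
    exact ⟨hcd.2 ⟨h0, h1⟩, h2, h3⟩

theorem isSobolevRep_of_contDiffOn (hab : a < b) {n : ℕ} (hn : 1 ≤ n) {g : ℝ → 𝕜}
    (hg : ContDiffOn ℝ (n : WithTop ℕ∞) g (Icc a b)) : IsSobolevRep p a b n g where
  contDiffOn := hg.of_le (by exact_mod_cast Nat.sub_le n 1)
  absCont := by
    refine ContDiffOn.absolutelyContinuousOnInterval ?_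
    rw [uIcc_of_le hab.le]
    obtain ⟨m, rfl⟩ : ∃ m, n = m + 1 := ⟨n - 1, by omega⟩
    exact ((contDiffOn_nat_succ_iff_contDiffOn_one_iteratedDerivWithin
      (uniqueDiffOn_Icc hab)).1 hg).2
  memLp := memLp_of_continuousOn
    (hg.continuousOn_iteratedDerivWithin le_rfl (uniqueDiffOn_Icc hab))

theorem IsSobolevRep.congr (hab : a < b) {n : ℕ} {g g' : ℝ → 𝕜} (hg : IsSobolevRep p a b n g)
    (h : EqOn g g' (Icc a b)) : IsSobolevRep p a b n g' where
  contDiffOn := hg.contDiffOn.congr h.symm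
  absCont := AbsolutelyContinuousOnInterval_congr
    (by rw [uIcc_of_le hab.le]; exact fun x hx => iteratedDerivWithin_congr h hx) hg.absCont
  memLp := by
    refine (memLp_congr_ae ?_).1 hg.memLp
    filter_upwards [ae_restrict_mem (μ := volume) (measurableSet_Ioo (a := a) (b := b))] with x hx
    exact iteratedDerivWithin_congr h (Ioo_subset_Icc_self hx)

theorem hasDerivWithinAt_primitive {u : ℝ → 𝕜} (hu : ContinuousOn u (Icc a b))
    {x : ℝ} (hx : x ∈ Icc a b) : HasDerivWithinAt (primitive a u) (u x) (Icc a b) x := by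
  have : Fact (x ∈ Icc a b) := ⟨hx⟩
  refine intervalIntegral.integral_hasDerivWithinAt_right ?_ ?_ (hu x hx)
  · exact (hu.mono (by rw [uIcc_of_le hx.1]; exact Icc_subset_Icc_right hx.2)).intervalIntegrable
  · exact hu.stronglyMeasurableAtFilter_nhdsWithin measurableSet_Icc x

/-- `f` has a representative `g ∈ W_p^n(a, b)` and `h` is the class of `g^{(n)}`. -/
def HasSobolevDeriv (n : ℕ) (f h : LpInterval 𝕜 p a b) : Prop :=
  ∃ g : ℝ → 𝕜, IsSobolevRep p a b n g ∧ f =ᵐ[intervalMeasure a b] g ∧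
    h =ᵐ[intervalMeasure a b] iteratedDerivWithin n g (Icc a b)

/-- The value of `D^n` does not depend on the chosen representative, so any admissible one
witnesses membership in the graph. -/
theorem mem_graph_derivOp_iff (hab : a < b) {n : ℕ} {f h : LpInterval 𝕜 p a b} :
    (f, h) ∈ (derivOp 𝕜 p hab n).graph ↔ HasSobolevDeriv n f h := by
  rw [LinearPMap.mem_graph_iff]
  constructor
  · rintro ⟨y, rfl, rfl⟩
    obtain ⟨g, hg, hfg⟩ := y.2
    exact ⟨g, hg, hfg, derivOp_apply_ae 𝕜 p hab n y hg hfg⟩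
  · rintro ⟨g, hg, hfg, hh⟩
    exact ⟨⟨f, g, hg, hfg⟩, rfl,
      Lp.ext ((derivOp_apply_ae 𝕜 p hab n ⟨f, g, hg, hfg⟩ hg hfg).trans hh.symm)⟩

variable [hp1 : Fact (1 ≤ p)]

theorem const_smul_oneLp_add_volterra_ae (hab : a < b) (c : 𝕜) (h : LpInterval 𝕜 p a b) :
    (c • oneLp 𝕜 p a b + volterra 𝕜 p hab h : LpInterval 𝕜 p a b) =ᵐ[intervalMeasure a b]
      fun x => c + primitive a h x := by
  filter_upwards [Lp.coeFn_add (c • oneLp 𝕜 p a b) (volterra 𝕜 p hab h),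
    Lp.coeFn_smul c (oneLp 𝕜 p a b), oneLp_ae (𝕜 := 𝕜) (p := p) (a := a) (b := b),
    volterra_ae hab h] with x h1 h2 h3 h4
  rw [h1, Pi.add_apply, h2, Pi.smul_apply, h3, h4, smul_eq_mul, mul_one]

theorem hasSobolevDeriv_one_iff (hab : a < b) {f h : LpInterval 𝕜 p a b} :
    HasSobolevDeriv 1 f h ↔ ∃ c : 𝕜, c • oneLp 𝕜 p a b + volterra 𝕜 p hab h = f := by
  constructor
  · rintro ⟨g, hg, hfg, hh⟩
    obtain ⟨c, hc⟩ := hg.eq_add_primitive hab (integrable_lp h) hh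
    refine ⟨c, Lp.ext ((const_smul_oneLp_add_volterra_ae hab c h).trans (.trans ?_ hfg.symm))⟩
    filter_upwards [ae_restrict_mem (μ := volume) (measurableSet_Ioo (a := a) (b := b))] with x hx
    exact (hc x (Ioo_subset_Icc_self hx)).symm
  · rintro ⟨c, rfl⟩
    obtain ⟨h1, h2⟩ :=
      isSobolevRep_one_const_add_primitive hab c (integrable_lp h) (Lp.memLp h)
    exact ⟨_, h1, const_smul_oneLp_add_volterra_ae hab c h, h2⟩

/-- `D^(n + 1)` is the composition of `D^n` and `D`, with the natural domain. -/
theorem hasSobolevDeriv_succ_iff (hab : a < b) {n : ℕ} (hn : 1 ≤ n) {f h : LpInterval 𝕜 p a b} :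
    HasSobolevDeriv (n + 1) f h ↔
      ∃ u : LpInterval 𝕜 p a b, HasSobolevDeriv 1 f u ∧ HasSobolevDeriv n u h := by
  constructor
  · rintro ⟨g, hg, hfg, hh⟩
    obtain ⟨hd, hg'⟩ := (isSobolevRep_succ_iff hab hn).1 hg
    rw [iteratedDerivWithin_succ'] at hh
    have hu : MemLp (derivWithin g (Icc a b)) p (intervalMeasure a b) :=
      memLp_of_continuousOn hg'.continuousOn
    -- As `n ≥ 1`, the function `g` is `C^1`, so its first derivative is itself an element of `L_p`.
    refine ⟨hu.toLp _, ⟨g, ?_, hfg, ?_⟩, ⟨_, hg', hu.coeFn_toLp, hh⟩⟩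
    · refine isSobolevRep_of_contDiffOn hab le_rfl (hg.contDiffOn.of_le ?_)
      exact_mod_cast (by omega : 1 ≤ n + 1 - 1)
    · rw [iteratedDerivWithin_one]
      exact hu.coeFn_toLp
  · rintro ⟨u, hfu, v, hv, huv, hh⟩
    obtain ⟨c, rfl⟩ := (hasSobolevDeriv_one_iff hab).1 hfu
    -- Integrating the continuous representative `v` of `u` gives a representative of `f` which is
    -- differentiable everywhere on `[a, b]`, with derivative `v`.
    have hder : ∀ x ∈ Icc a b,
        HasDerivWithinAt (fun x => c + primitive a v x) (v x) (Icc a b) x := fun x hx =>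
      (hasDerivWithinAt_primitive hv.continuousOn hx).const_add c
    have hEq : EqOn (derivWithin (fun x => c + primitive a v x) (Icc a b)) v (Icc a b) :=
      fun x hx => (hder x hx).derivWithin (uniqueDiffOn_Icc hab x hx)
    refine ⟨fun x => c + primitive a v x, (isSobolevRep_succ_iff hab hn).2
      ⟨fun x hx => (hder x hx).differentiableWithinAt, ?_⟩, ?_, ?_⟩
    · exact hv.congr hab hEq.symm
    · refine (const_smul_oneLp_add_volterra_ae hab c u).trans ?_
      filter_upwards [ae_restrict_mem (μ := volume) (measurableSet_Ioo (a := a) (b := b))] with x hx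
      rw [primitive_congr huv (Ioo_subset_Icc_self hx)]
    · refine hh.trans ?_
      filter_upwards [ae_restrict_mem (μ := volume) (measurableSet_Ioo (a := a) (b := b))] with x hx
      rw [iteratedDerivWithin_succ']
      exact (iteratedDerivWithin_congr hEq (Ioo_subset_Icc_self hx)).symm

/-- Iterated integration: `h` is the `n`th derivative of `f` if and only if `f` differs from the
`n`-fold primitive of `h` by a combination of `1, V 1, …, V ^ (n - 1) 1`, that is, by a polynomial
of degree less than `n`. -/
theorem hasSobolevDeriv_iff (hab : a < b) {n : ℕ} (hn : 1 ≤ n) {f h : LpInterval 𝕜 p a b} :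
    HasSobolevDeriv n f h ↔ f - (volterra 𝕜 p hab ^ n) h ∈
      iterateSpan (volterra 𝕜 p hab) (oneLp 𝕜 p a b) n := by
  induction n, hn using Nat.le_induction generalizing f with
  | base =>
    rw [hasSobolevDeriv_one_iff hab, iterateSpan, iterateSpan, Submodule.map_bot, sup_bot_eq,
      pow_one, Submodule.mem_span_singleton]
    simp only [eq_sub_iff_add_eq]
  | succ n hn ih =>
    rw [hasSobolevDeriv_succ_iff hab hn, iterateSpan, Submodule.mem_sup, pow_succ']
    simp only [Submodule.mem_span_singleton, Submodule.mem_map]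
    constructor
    · rintro ⟨u, hfu, huh⟩
      obtain ⟨c, rfl⟩ := (hasSobolevDeriv_one_iff hab).1 hfu
      refine ⟨_, ⟨c, rfl⟩, _, ⟨_, ih.1 huh, rfl⟩, ?_⟩
      change _ + volterra 𝕜 p hab _ = _ - volterra 𝕜 p hab ((volterra 𝕜 p hab ^ n) h)
      rw [map_sub, add_sub_assoc]
    · rintro ⟨_, ⟨c, rfl⟩, _, ⟨ν, hν, rfl⟩, hf⟩
      refine ⟨ν + (volterra 𝕜 p hab ^ n) h, (hasSobolevDeriv_one_iff hab).2 ⟨c, ?_⟩, ih.2 ?_⟩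
      · rw [map_add, ← add_assoc]
        exact (eq_sub_iff_add_eq.1 hf)
      · rwa [add_sub_cancel_right]

/-! ### Properties of `D^n` -/

/-- The domain contains the classes of compactly supported smooth functions. -/
theorem dense_domain_derivOp (hp : p ≠ ∞) (hab : a < b) {n : ℕ} (hn : 1 ≤ n) :
    Dense ((derivOp 𝕜 p hab n).domain : Set (LpInterval 𝕜 p a b)) := by
  refine (Lp.dense_hasCompactSupport_contDiff hp).mono ?_
  rintro f ⟨g, hfg, -, hg⟩
  exact ⟨g, isSobolevRep_of_contDiffOn hab hn
    ((hg.of_le (by exact_mod_cast le_top)).contDiffOn), hfg⟩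

theorem mem_graph_derivOp_iff_mem_iterateSpan (hab : a < b) {n : ℕ} (hn : 1 ≤ n)
    (f h : LpInterval 𝕜 p a b) :
    (f, h) ∈ (derivOp 𝕜 p hab n).graph ↔ f - (volterra 𝕜 p hab ^ n) h ∈
      iterateSpan (volterra 𝕜 p hab) (oneLp 𝕜 p a b) n :=
  (mem_graph_derivOp_iff hab).trans (hasSobolevDeriv_iff hab hn)

theorem rank_iterateSpan_volterra (hab : a < b) (n : ℕ) :
    Module.rank 𝕜 (iterateSpan (volterra 𝕜 p hab) (oneLp 𝕜 p a b) n) = n :=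
  rank_iterateSpan (volterra_injective hab) (volterra_ne_oneLp hab) n

theorem nontrivial_lpInterval (hab : a < b) : Nontrivial (LpInterval 𝕜 p a b) :=
  ⟨⟨oneLp 𝕜 p a b, 0, fun h => volterra_ne_oneLp (p := p) hab (0 : LpInterval 𝕜 p a b)
    (by rw [map_zero, h])⟩⟩

theorem isClosed_derivOp (hab : a < b) {n : ℕ} (hn : 1 ≤ n) : (derivOp 𝕜 p hab n).IsClosed := by
  have : FiniteDimensional 𝕜 (iterateSpan (volterra 𝕜 p hab) (oneLp 𝕜 p a b) n) :=
    Module.rank_lt_aleph0_iff.1 (by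
      rw [rank_iterateSpan_volterra]
      exact Cardinal.natCast_lt_aleph0)
  exact isClosed_of_mem_graph_iff (mem_graph_derivOp_iff_mem_iterateSpan hab hn)

theorem not_isBoundedOp_derivOp (hab : a < b) {n : ℕ} (hn : 1 ≤ n) :
    ¬ IsBoundedOp (derivOp 𝕜 p hab n) :=
  have := nontrivial_lpInterval (𝕜 := 𝕜) (p := p) hab
  not_isBoundedOp_of_mem_graph_iff ((isQuasinilpotent_volterra hab).pow hn)
    (mem_graph_derivOp_iff_mem_iterateSpan hab hn)

theorem rank_eigenspace_derivOp (hab : a < b) {n : ℕ} (hn : 1 ≤ n) (μ : 𝕜) :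
    Module.rank 𝕜 (eigenspace (derivOp 𝕜 p hab n) μ) = n :=
  (rank_eigenspace_of_mem_graph_iff ((isQuasinilpotent_volterra hab).pow hn)
    (mem_graph_derivOp_iff_mem_iterateSpan hab hn) μ).trans (rank_iterateSpan_volterra hab n)

theorem pointSpectrum_derivOp (hab : a < b) {n : ℕ} (hn : 1 ≤ n) :
    pointSpectrum (derivOp 𝕜 p hab n) = univ := by
  refine eq_univ_of_forall fun μ => mem_pointSpectrum_of_eigenspace_ne_bot fun h => ?_
  have := rank_eigenspace_derivOp (𝕜 := 𝕜) (p := p) hab hn μ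
  rw [h, rank_bot] at this
  exact (Nat.one_le_iff_ne_zero.1 hn) (by exact_mod_cast this.symm)

end Sobolev

end LpDerivative

theorem proposition3p3 (p : ℝ≥0∞) [Fact (1 ≤ p)] (hp : p ≠ ∞) (a b : ℝ) (hab : a < b)
    (n : ℕ) (hn : 1 ≤ n) :
    -- real or complex scalars
    (∀ (𝕜 : Type*) [RCLike 𝕜],
      Dense ((LpDerivative.derivOp 𝕜 p hab n).domain : Set (LpDerivative.LpInterval 𝕜 p a b)) ∧
      ¬ LpDerivative.IsBoundedOp (LpDerivative.derivOp 𝕜 p hab n) ∧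
      (LpDerivative.derivOp 𝕜 p hab n).IsClosed) ∧
    -- complex scalars
    LpDerivative.spectrum (LpDerivative.derivOp ℂ p hab n) = Set.univ ∧
    LpDerivative.pointSpectrum (LpDerivative.derivOp ℂ p hab n) = Set.univ ∧
    ∀ μ : ℂ, Module.rank ℂ (LpDerivative.eigenspace (LpDerivative.derivOp ℂ p hab n) μ) = n := by
  have hσ := LpDerivative.pointSpectrum_derivOp (𝕜 := ℂ) (p := p) hab hn
  refine ⟨fun 𝕜 _ => ⟨LpDerivative.dense_domain_derivOp hp hab hn,
    LpDerivative.not_isBoundedOp_derivOp hab hn, LpDerivative.isClosed_derivOp hab hn⟩, ?_, hσ,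
    LpDerivative.rank_eigenspace_derivOp hab hn⟩
  exact Set.univ_subset_iff.1 (hσ ▸ LpDerivative.pointSpectrum_subset_spectrum _)
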